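/- Let $n\ge 0$ and let $K$ be a centrally symmetric convex $(2n+4)$-gon with center $o$. All triangulations of $K$ are without new vertices and centrally symmetric with respect to $o$; each has exactly one diagonal through $o$ (its central diagonal), and its other $2n$ diagonals form $n$ centrally symmetric pairs. A flip of such a triangulation replaces either its central diagonal by another one, or both diagonals of a centrally symmetric pair simultaneously by those of another centrally symmetric pair, so that again a centrally symmetric triangulation results, all other diagonals being kept. The ordinary cyclohedron $\mathcal{Z}_n$ is the polytope of rank $n+1$ whose nonempty faces are given by their vertex sets $\{s : D\subseteq s\}$, where $D$ runs over the centrally symmetric sets of diagonals contained in some centrally symmetric triangulation and $s$ over all centrally symmetric triangulations; together with the empty face, they are ordered by inclusion. A colored triangulation is a centrally symmetric triangulation of $K$ whose $n$ pairs of non-central diagonals are colored bijectively with the elements of an $n$-set $C(K)$ of colors, the two diagonals of a pair receiving the same color; the central diagonal receives only the "uncolor" $c^*\notin C(K)$. Flips of colored triangulations preserve colors: the new diagonals receive the color of the ones they replace, and all other diagonals keep theirs. The colorful cyclohedron $\mathcal{Z}^c_n$ is the abstract polytope of rank $n+1$ whose nonempty faces are the pairs $(C,t)$, with $C\subseteq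 C(K)\cup\{c^*\}$ and $t$ a colored triangulation, identified with the set of all colored triangulations obtained from $t$ by sequences of flips of diagonals with colors in $C$; together with the empty face, they are ordered by inclusion. The symmetric group $S_n$ of permutations of $C(K)$ acts on $\mathcal{Z}^c_n$ by $\sigma(C,t)=(\sigma(C),t_\sigma)$, where $\sigma(c^*)=c^*$ and $t_\sigma$ is obtained from $t$ by replacing each color $c$ by $\sigma(c)$. The faces of the quotient $\mathcal{Z}^c_n/S_n$ are the orbits of faces of $\mathcal{Z}^c_n$ under $S_n$, with $P\le Q$ if and only if there are faces $F\in P$ and $G\in Q$ with $F\le G$. Theorem. For every $n\ge 0$, $$\mathcal{Z}^c_n/S_n\;\cong\;\mathcal{Z}_n$$ as partially ordered sets of faces (isomorphism of abstract polytopes). -/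

import Mathlib

namespace Cyclohedron

/-- The vertices of the centrally symmetric convex `(2n+4)`-gon `K`, labelled in cyclic order. -/
abbrev Vertex (n : ℕ) : Type := Fin (2 * n + 4)

/-- The central symmetry of `K` on vertices: `i ↦ i + (n + 2)` modulo `2n + 4`. -/
def opp {n : ℕ} (i : Vertex n) : Vertex n :=
  ⟨(i.val + (n + 2)) % (2 * n + 4), Nat.mod_lt _ (by omega)⟩

/-- The central symmetry of `K` on unordered pairs of vertices. -/
def oppPair {n : ℕ} (x : Sym2 (Vertex n)) : Sym2 (Vertex n) := Sym2.map opp x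

/-- A diagonal of `K` is a pair of vertices that are distinct and not neighbours on the boundary
(the last inequality excludes the side joining the last vertex to the first). -/
def IsDiagonal {n : ℕ} (x : Sym2 (Vertex n)) : Prop :=
  ∃ a b : Vertex n, x = s(a, b) ∧ a.val + 1 < b.val ∧ b.val + 1 < a.val + (2 * n + 4)

/-- A diagonal is central if it joins a vertex to the opposite vertex. -/
def IsCentral {n : ℕ} (x : Sym2 (Vertex n)) : Prop :=
  ∃ a : Vertex n, x = s(a, opp a)

/-- Two diagonals cross in the interior of `K`: their four end points are distinct and alternate
along the boundary. -/
def Crosses {n : ℕ} (x y : Sym2 (Vertex n)) : Prop :=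
  ∃ a b c d : Vertex n, a < c ∧ c < b ∧ b < d ∧
    ((x = s(a, b) ∧ y = s(c, d)) ∨ (x = s(c, d) ∧ y = s(a, b)))

/-- A set of pairwise non-crossing diagonals of `K`. -/
def IsNoncrossing {n : ℕ} (D : Set (Sym2 (Vertex n))) : Prop :=
  (∀ x ∈ D, IsDiagonal x) ∧ ∀ x ∈ D, ∀ y ∈ D, ¬ Crosses x y

/-- A triangulation of `K`, given by its diagonals: a maximal set of pairwise non-crossing
diagonals. -/
def IsTriangulation {n : ℕ} (D : Set (Sym2 (Vertex n))) : Prop :=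
  Maximal IsNoncrossing D

/-- The centrally symmetric (uncolored) triangulations of `K`. -/
@[ext]
structure SymTriangulation (n : ℕ) where
  /-- the set of diagonals -/
  diagonals : Set (Sym2 (Vertex n))
  isTriangulation : IsTriangulation diagonals
  symmetric : ∀ x ∈ diagonals, oppPair x ∈ diagonals

/-- `t'` is obtained from `t` by flipping `x` into `y` together with the flip of the opposite
diagonal of `x` into the opposite diagonal of `y` (if `x` is central, it is its own opposite and
this is a single flip): the old diagonals are exchanged for new ones, all the others being kept,
so that a triangulation results. -/
def IsFlip {n : ℕ} (t t' : SymTriangulation n) (x y : Sym2 (Vertex n)) : Prop :=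
  x ∈ t.diagonals ∧ y ∉ t.diagonals ∧
    t'.diagonals = (t.diagonals \ {x, oppPair x}) ∪ {y, oppPair y}

/-! ### The ordinary cyclohedron -/

/-- The vertex sets of the faces of the ordinary cyclohedron: the empty face, and, for each
centrally symmetric set `D` of diagonals of a centrally symmetric triangulation, the set of all
centrally symmetric triangulations that contain `D`. -/
def IsCyclohedronFace {n : ℕ} (F : Set (SymTriangulation n)) : Prop :=
  F = ∅ ∨ ∃ (t : SymTriangulation n) (D : Set (Sym2 (Vertex n))),
    D ⊆ t.diagonals ∧ (∀ x ∈ D, oppPair x ∈ D) ∧ F = {s | D ⊆ s.diagonals}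

/-- The ordinary cyclohedron, as an abstract polytope: its faces. -/
@[ext]
structure CyclohedronFace (n : ℕ) where
  /-- the vertex set of the face -/
  vertices : Set (SymTriangulation n)
  isFace : IsCyclohedronFace vertices

/-- Faces are ordered by inclusion of their vertex sets. -/
instance (n : ℕ) : PartialOrder (CyclohedronFace n) :=
  PartialOrder.lift CyclohedronFace.vertices (fun _ _ h => CyclohedronFace.ext h)

/-! ### The colorful cyclohedron -/

/-- The colored triangulations of `K`, with color set `Fin n`. Here `color x = some c` means that
`x` carries the color `c`; the pairs that are not diagonals of the triangulation, and its central
diagonal, carry no color, `color x = none`. Two non-central diagonals have the same color exactly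
if they are equal or opposite. -/
@[ext]
structure ColoredTriangulation (n : ℕ) where
  /-- the underlying uncolored triangulation -/
  supp : SymTriangulation n
  /-- the coloring -/
  color : Sym2 (Vertex n) → Option (Fin n)
  isSome_color_iff : ∀ x, (color x).isSome ↔ x ∈ supp.diagonals ∧ ¬ IsCentral x
  color_eq_iff : ∀ x ∈ supp.diagonals, ∀ y ∈ supp.diagonals, ¬ IsCentral x → ¬ IsCentral y →
    (color x = color y ↔ y = x ∨ y = oppPair x)

/-- `t'` is obtained from `t` by a color preserving flip of the diagonal or diagonals of color `c`,
where `c` lies in the extended color set `Option (Fin n)` and `none` is the "uncolor" of the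
central diagonal. -/
def IsColoredFlip {n : ℕ} (c : Option (Fin n)) (t t' : ColoredTriangulation n) : Prop :=
  ∃ x y, IsFlip t.supp t'.supp x y ∧ t.color x = c ∧ t'.color y = c ∧
    ∀ z ∈ t.supp.diagonals, z ∈ t'.supp.diagonals → t'.color z = t.color z

theorem oppPair_oppPair {n : ℕ} (x : Sym2 (Vertex n)) : oppPair (oppPair x) = x := by
  have h : (opp ∘ opp : Vertex n → Vertex n) = id := by
    funext i
    have hi := i.isLt
    apply Fin.ext
    simp only [Function.comp_apply, opp, id_eq]
    rcases Nat.lt_or_ge (i.val + (n + 2)) (2 * n + 4) with h1 | h1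
    · rw [Nat.mod_eq_of_lt h1, show i.val + (n + 2) + (n + 2) = i.val + (2 * n + 4) by omega,
        Nat.add_mod_right, Nat.mod_eq_of_lt hi]
    · have h2 : (i.val + (n + 2)) % (2 * n + 4) = i.val + (n + 2) - (2 * n + 4) := by
        rw [Nat.mod_eq_sub_mod h1, Nat.mod_eq_of_lt (by omega)]
      rw [h2, Nat.mod_eq_of_lt (by omega)]
      omega
  unfold oppPair
  rw [Sym2.map_map, h, Sym2.map_id, id]

theorem IsFlip.symm {n : ℕ} {t t' : SymTriangulation n} {x y : Sym2 (Vertex n)}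
    (h : IsFlip t t' x y) : IsFlip t' t y x := by
  obtain ⟨hx, hy, he⟩ := h
  have hx' := t.symmetric x hx
  have hy' : oppPair y ∉ t.diagonals := fun h => hy (by
    have := t.symmetric _ h
    rwa [oppPair_oppPair] at this)
  refine ⟨by rw [he]; simp, ?_, ?_⟩
  · rw [he]
    rintro (⟨-, h⟩ | h | h)
    · exact h (Or.inl rfl)
    · exact hy (h ▸ hx)
    · exact hy' ((show x = oppPair y from h) ▸ hx)
  · ext z
    rw [he]
    simp only [Set.mem_union, Set.mem_sdiff, Set.mem_insert_iff, Set.mem_singleton_iff]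
    constructor
    · intro hz
      by_cases h : z = x ∨ z = oppPair x
      · exact Or.inr h
      · refine Or.inl ⟨Or.inl ⟨hz, h⟩, ?_⟩
        rintro (rfl | rfl)
        · exact hy hz
        · exact hy' hz
    · rintro (⟨⟨h, -⟩ | h, h2⟩ | rfl | rfl)
      · exact h
      · exact absurd h h2
      · exact hx
      · exact hx'

theorem IsColoredFlip.symm {n : ℕ} {c : Option (Fin n)} {t t' : ColoredTriangulation n}
    (h : IsColoredFlip c t t') : IsColoredFlip c t' t := by
  obtain ⟨x, y, h, hx, hy, hz⟩ := h
  exact ⟨y, x, h.symm, hy, hx, fun z h1 h2 => (hz z h2 h1).symm⟩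

theorem IsColoredFlip.ne {n : ℕ} {c : Option (Fin n)} {t t' : ColoredTriangulation n}
    (h : IsColoredFlip c t t') : t ≠ t' := by
  rintro rfl
  obtain ⟨x, y, h, -⟩ := h
  exact h.2.1 h.symm.1

/-- The edges with colors in `C` of the colorful exchange graph: two colored triangulations are
adjacent if they differ by a color preserving flip of the diagonals of one color `c ∈ C`.
For `C = Set.univ` this is the whole colorful exchange graph. -/
def exchangeGraph {n : ℕ} (C : Set (Option (Fin n))) : SimpleGraph (ColoredTriangulation n) where
  Adj t t' := ∃ c ∈ C, IsColoredFlip c t t'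
  symm := ⟨fun _ _ ⟨c, hc, h⟩ => ⟨c, hc, h.symm⟩⟩
  loopless := ⟨fun _ ⟨_, _, h⟩ => h.ne rfl⟩

/-- The vertex set of the face `(C, t)` of the colorful cyclohedron: all colored triangulations
that are joined to `t` by a path in the colorful exchange graph with edge colors in `C`. -/
def faceVertices {n : ℕ} (C : Set (Option (Fin n))) (t : ColoredTriangulation n) :
    Set (ColoredTriangulation n) :=
  {s | (exchangeGraph C).Reachable t s}

/-- The vertex sets of the faces of the colorful cyclohedron: the empty face and the `(C, t)`. -/
def IsColorfulFace {n : ℕ} (F : Set (ColoredTriangulation n)) : Prop :=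
  F = ∅ ∨ ∃ (C : Set (Option (Fin n))) (t : ColoredTriangulation n), F = faceVertices C t

/-- The colorful cyclohedron, as an abstract polytope: its faces. -/
@[ext]
structure ColorfulCyclohedronFace (n : ℕ) where
  /-- the vertex set of the face -/
  vertices : Set (ColoredTriangulation n)
  isFace : IsColorfulFace vertices

/-- Faces are ordered by inclusion of their vertex sets. -/
instance (n : ℕ) : PartialOrder (ColorfulCyclohedronFace n) :=
  PartialOrder.lift ColorfulCyclohedronFace.vertices (fun _ _ h => ColorfulCyclohedronFace.ext h)

/-! ### The action of the symmetric group on the colors -/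

/-- `recolor σ t` replaces each color `c` of `t` by `σ c`. -/
def recolor {n : ℕ} (σ : Equiv.Perm (Fin n)) (t : ColoredTriangulation n) :
    ColoredTriangulation n where
  supp := t.supp
  color x := (t.color x).map σ
  isSome_color_iff x := by rw [Option.isSome_map]; exact t.isSome_color_iff x
  color_eq_iff x hx y hy hx' hy' := by
    rw [(Option.map_injective σ.injective).eq_iff]
    exact t.color_eq_iff x hx y hy hx' hy'

instance (n : ℕ) : MulAction (Equiv.Perm (Fin n)) (ColoredTriangulation n) where
  smul := recolor
  one_smul t := by
    apply ColoredTriangulation.ext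
    · rfl
    · funext x
      change (t.color x).map (1 : Equiv.Perm (Fin n)) = t.color x
      simp
  mul_smul σ τ t := by
    apply ColoredTriangulation.ext
    · rfl
    · funext x
      change (t.color x).map (σ * τ : Equiv.Perm (Fin n)) = ((t.color x).map τ).map σ
      simp [Option.map_map]

theorem IsColoredFlip.smul {n : ℕ} {c : Option (Fin n)} {t t' : ColoredTriangulation n}
    (h : IsColoredFlip c t t') (σ : Equiv.Perm (Fin n)) :
    IsColoredFlip (c.map σ) (σ • t) (σ • t') := by
  obtain ⟨x, y, h, hx, hy, hz⟩ := h
  exact ⟨x, y, h, congrArg (Option.map σ) hx, congrArg (Option.map σ) hy,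
    fun z h1 h2 => congrArg (Option.map σ) (hz z h1 h2)⟩

theorem reachable_smul {n : ℕ} {C : Set (Option (Fin n))} {t s : ColoredTriangulation n}
    (h : (exchangeGraph C).Reachable t s) (σ : Equiv.Perm (Fin n)) :
    (exchangeGraph (Option.map σ '' C)).Reachable (σ • t) (σ • s) :=
  h.map (G' := exchangeGraph (Option.map σ '' C))
    { toFun := fun t => σ • t
      map_rel' := by
        rintro t s ⟨c, hc, h⟩
        exact ⟨c.map σ, ⟨c, hc, rfl⟩, h.smul σ⟩ }

/-- A permutation `σ` of the colors maps the face `(C, t)` to the face `(σ(C), σ • t)`. -/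
theorem image_smul_faceVertices {n : ℕ} (σ : Equiv.Perm (Fin n)) (C : Set (Option (Fin n)))
    (t : ColoredTriangulation n) :
    (fun s => σ • s) '' faceVertices C t = faceVertices (Option.map σ '' C) (σ • t) := by
  ext s
  constructor
  · rintro ⟨s, hs, rfl⟩
    exact reachable_smul hs σ
  · intro hs
    refine ⟨σ⁻¹ • s, ?_, smul_inv_smul σ s⟩
    have := reachable_smul hs σ⁻¹
    rw [inv_smul_smul, Set.image_image] at this
    simpa [faceVertices, Option.map_map] using this

/-- The symmetric group on the `n` colors acts on the faces of the colorful cyclohedron, a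
permutation moving every vertex of a face. -/
instance (n : ℕ) : MulAction (Equiv.Perm (Fin n)) (ColorfulCyclohedronFace n) where
  smul σ F := ⟨(fun s => σ • s) '' F.vertices, by
    rcases F.isFace with h | ⟨C, t, h⟩
    · left; rw [h, Set.image_empty]
    · right; exact ⟨_, _, by rw [h, image_smul_faceVertices]⟩⟩
  one_smul F := by
    apply ColorfulCyclohedronFace.ext
    change (fun s => (1 : Equiv.Perm (Fin n)) • s) '' F.vertices = F.vertices
    simp
  mul_smul σ τ F := by
    apply ColorfulCyclohedronFace.ext
    change (fun s => (σ * τ) • s) '' F.vertices =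
      (fun s => σ • s) '' ((fun s => τ • s) '' F.vertices)
    rw [Set.image_image]
    simp [mul_smul]

/-- The faces of the quotient of the colorful cyclohedron by the symmetric group on the colors:
the orbits of faces. -/
def QuotientFace (n : ℕ) : Type :=
  MulAction.orbitRel.Quotient (Equiv.Perm (Fin n)) (ColorfulCyclohedronFace n)

/-- The orbit of a face. -/
def orbit {n : ℕ} (F : ColorfulCyclohedronFace n) : QuotientFace n :=
  Quotient.mk (MulAction.orbitRel (Equiv.Perm (Fin n)) (ColorfulCyclohedronFace n)) F

/-- Two orbits are incident in the quotient if they are the orbits of two incident faces. -/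
instance (n : ℕ) : LE (QuotientFace n) where
  le P Q := ∃ F G : ColorfulCyclohedronFace n, orbit F = P ∧ orbit G = Q ∧ F ≤ G

end Cyclohedron

namespace Cyclohedron

/-! ### Crossing diagonals -/

/-! Forgetting colors sends the face `(C, T)` to the set of all triangulations containing
`fixedDiagonals C T`, the diagonals of `T` with color outside `C` (`image_supp_faceVertices`). Flips
with colors in `C` never remove these. Conversely, two symmetric triangulations are joined by flips
that keep their common diagonals (`reflTransGen_flipStep`); each flip lifts to a colored one, whose
color must lie in `C` because otherwise it would remove a fixed diagonal.

Every face of the ordinary cyclohedron arises in this way: a triangulation has at most `2n+1`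
diagonals, hence a coloring, and `C` can be taken as the set of colors outside `D`. Two colorings of
one triangulation differ by a permutation (`exists_smul_eq`), so faces with comparable nonempty
images can be moved to share a vertex; there, inclusion of images forces inclusion of faces
(`faceVertices_subset`). So the map on orbits is bijective and preserves and reflects order.

The geometry is coordinate arithmetic: with ordered end points, crossing is a system of linear
inequalities. -/

theorem crosses_mk {n : ℕ} {a b c d : Vertex n} (hab : a < b) (hcd : c < d) :
    Crosses s(a, b) s(c, d) ↔ (a < c ∧ c < b ∧ b < d) ∨ (c < a ∧ a < d ∧ d < b) := by
  constructor
  · rintro ⟨a', b', c', d', h1, h2, h3, ⟨hx, hy⟩ | ⟨hx, hy⟩⟩ <;>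
      rw [Sym2.eq_iff] at hx hy <;>
      rcases hx with ⟨rfl, rfl⟩ | ⟨rfl, rfl⟩ <;> rcases hy with ⟨rfl, rfl⟩ | ⟨rfl, rfl⟩ <;> lia
  · rintro (⟨h1, h2, h3⟩ | ⟨h1, h2, h3⟩)
    · exact ⟨a, b, c, d, h1, h2, h3, Or.inl ⟨rfl, rfl⟩⟩
    · exact ⟨c, d, a, b, h1, h2, h3, Or.inr ⟨rfl, rfl⟩⟩

theorem Crosses.symm {n : ℕ} {x y : Sym2 (Vertex n)} (h : Crosses x y) : Crosses y x := by
  obtain ⟨a, b, c, d, h1, h2, h3, h⟩ := h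
  exact ⟨a, b, c, d, h1, h2, h3, h.symm.imp And.symm And.symm⟩

theorem Crosses.isDiagonal {n : ℕ} {x y : Sym2 (Vertex n)} (h : Crosses x y) : IsDiagonal x := by
  obtain ⟨a, b, c, d, h1, h2, h3, ⟨rfl, rfl⟩ | ⟨rfl, rfl⟩⟩ := h
  · exact ⟨a, b, rfl, by lia, by lia⟩
  · exact ⟨c, d, rfl, by lia, by lia⟩

theorem isDiagonal_mk {n : ℕ} {a b : Vertex n} (hab : a < b) :
    IsDiagonal s(a, b) ↔ a.val + 1 < b.val ∧ b.val + 1 < a.val + (2 * n + 4) := by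
  constructor
  · rintro ⟨a', b', h, h1, h2⟩
    rw [Sym2.eq_iff] at h
    rcases h with ⟨rfl, rfl⟩ | ⟨rfl, rfl⟩ <;> lia
  · rintro ⟨h1, h2⟩
    exact ⟨a, b, rfl, h1, h2⟩

theorem IsDiagonal.exists_lt {n : ℕ} {x : Sym2 (Vertex n)} (h : IsDiagonal x) :
    ∃ a b : Vertex n, a < b ∧ x = s(a, b) := by
  obtain ⟨a, b, rfl, h1, -⟩ := h
  exact ⟨a, b, by lia, rfl⟩

theorem not_crosses_self {n : ℕ} (x : Sym2 (Vertex n)) : ¬ Crosses x x := by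
  intro h
  obtain ⟨a, b, hab, rfl⟩ := h.isDiagonal.exists_lt
  rw [crosses_mk hab hab] at h
  lia

/-- Non-crossing is a condition on pairs and no diagonal crosses itself, so maximality can be tested
by adding one diagonal at a time. -/
theorem isTriangulation_iff {n : ℕ} {D : Set (Sym2 (Vertex n))} :
    IsTriangulation D ↔ ∀ x, x ∈ D ↔ IsDiagonal x ∧ ∀ z ∈ D, ¬ Crosses z x := by
  constructor
  · intro h x
    refine ⟨fun hx => ⟨h.prop.1 x hx, fun z hz => h.prop.2 z hz x hx⟩, fun ⟨hx, hz⟩ => ?_⟩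
    refine h.mem_of_prop_insert ⟨?_, ?_⟩
    · rintro y (rfl | hy)
      · exact hx
      · exact h.prop.1 y hy
    · rintro y (rfl | hy) z (rfl | hz')
      · exact not_crosses_self _
      · exact fun hc => hz z hz' hc.symm
      · exact hz y hy
      · exact h.prop.2 y hy z hz'
  · intro h
    refine ⟨⟨fun x hx => ((h x).1 hx).1, fun x hx y hy => ((h y).1 hy).2 x hx⟩, ?_⟩
    intro E hE hDE x hx
    exact (h x).2 ⟨hE.1 x hx, fun z hz => hE.2 z (hDE hz) x hx⟩

/-! ### Rotations of the polygon -/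

/-- The rotation of `K` by `c` on unordered pairs of vertices. -/
def rotPair {n : ℕ} (c : Vertex n) (x : Sym2 (Vertex n)) : Sym2 (Vertex n) := Sym2.map (· + c) x

@[simp] theorem rotPair_mk {n : ℕ} (c a b : Vertex n) : rotPair c s(a, b) = s(a + c, b + c) := rfl

theorem rotPair_rotPair {n : ℕ} (c d : Vertex n) (x : Sym2 (Vertex n)) :
    rotPair c (rotPair d x) = rotPair (d + c) x := by
  induction x with | _ a b => simp [add_assoc]

@[simp] theorem rotPair_zero {n : ℕ} (x : Sym2 (Vertex n)) : rotPair 0 x = x := by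
  induction x with | _ a b => simp

@[simp] theorem rotPair_neg_rotPair {n : ℕ} (c : Vertex n) (x : Sym2 (Vertex n)) :
    rotPair (-c) (rotPair c x) = x := by simp [rotPair_rotPair]

@[simp] theorem rotPair_rotPair_neg {n : ℕ} (c : Vertex n) (x : Sym2 (Vertex n)) :
    rotPair c (rotPair (-c) x) = x := by simp [rotPair_rotPair]

theorem val_add_cases {n : ℕ} (a c : Vertex n) :
    (a.val + c.val < 2 * n + 4 ∧ (a + c).val = a.val + c.val) ∨
      (2 * n + 4 ≤ a.val + c.val ∧ (a + c).val + (2 * n + 4) = a.val + c.val) := by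
  rw [Fin.val_add]
  rcases Nat.lt_or_ge (a.val + c.val) (2 * n + 4) with h | h
  · exact Or.inl ⟨h, Nat.mod_eq_of_lt h⟩
  · refine Or.inr ⟨h, ?_⟩
    rw [Nat.mod_eq_sub_mod h, Nat.mod_eq_of_lt (by lia)]
    lia

theorem opp_cases {n : ℕ} (a : Vertex n) :
    (a.val < n + 2 ∧ (opp a).val = a.val + (n + 2)) ∨
      (n + 2 ≤ a.val ∧ (opp a).val + (n + 2) = a.val) := by
  have := val_add_cases a ⟨n + 2, by omega⟩
  have h : a + ⟨n + 2, by omega⟩ = opp a := Fin.ext (by rw [Fin.val_add]; rfl)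
  rw [h] at this
  simp only at this
  lia

theorem oppPair_eq_rotPair {n : ℕ} (x : Sym2 (Vertex n)) :
    oppPair x = rotPair ⟨n + 2, by omega⟩ x := by
  have h : (opp : Vertex n → Vertex n) = (· + ⟨n + 2, by omega⟩) :=
    funext fun a => Fin.ext (by rw [Fin.val_add]; rfl)
  rw [oppPair, rotPair, h]

@[simp] theorem oppPair_mk {n : ℕ} (a b : Vertex n) : oppPair s(a, b) = s(opp a, opp b) := rfl

theorem opp_opp {n : ℕ} (a : Vertex n) : opp (opp a) = a := by
  have := opp_cases a
  have := opp_cases (opp a)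
  lia

theorem opp_ne {n : ℕ} (a : Vertex n) : opp a ≠ a := by
  have := opp_cases a
  lia

theorem rotPair_oppPair {n : ℕ} (c : Vertex n) (x : Sym2 (Vertex n)) :
    rotPair c (oppPair x) = oppPair (rotPair c x) := by
  simp only [oppPair_eq_rotPair, rotPair_rotPair, add_comm]

theorem Crosses.rotPair {n : ℕ} {x y : Sym2 (Vertex n)} (h : Crosses x y) (k : Vertex n) :
    Crosses (rotPair k x) (rotPair k y) := by
  have key : ∀ a b c d : Vertex n, a < c → c < b → b < d →
      Crosses s(a + k, b + k) s(c + k, d + k) := by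
    intro a b c d h1 h2 h3
    have ha := val_add_cases a k
    have hb := val_add_cases b k
    have hc := val_add_cases c k
    have hd := val_add_cases d k
    -- As `a < c < b < d`, the vertices that wrap around form a final segment of this list; this
    -- leaves five cases.
    by_cases wd : d.val + k.val < 2 * n + 4
    · exact ⟨_, _, _, _, by lia, by lia, by lia, Or.inl ⟨rfl, rfl⟩⟩
    by_cases wb : b.val + k.val < 2 * n + 4
    · exact ⟨d + k, c + k, a + k, b + k, by lia, by lia, by lia,
        Or.inr ⟨rfl, Sym2.eq_swap⟩⟩
    by_cases wc : c.val + k.val < 2 * n + 4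
    · exact ⟨b + k, a + k, d + k, c + k, by lia, by lia, by lia,
        Or.inl ⟨Sym2.eq_swap, Sym2.eq_swap⟩⟩
    by_cases wa : a.val + k.val < 2 * n + 4
    · exact ⟨c + k, d + k, b + k, a + k, by lia, by lia, by lia,
        Or.inr ⟨Sym2.eq_swap, rfl⟩⟩
    · exact ⟨_, _, _, _, by lia, by lia, by lia, Or.inl ⟨rfl, rfl⟩⟩
  obtain ⟨a, b, c, d, h1, h2, h3, ⟨rfl, rfl⟩ | ⟨rfl, rfl⟩⟩ := h
  · exact key a b c d h1 h2 h3
  · exact (key a b c d h1 h2 h3).symm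

theorem crosses_rotPair {n : ℕ} {x y : Sym2 (Vertex n)} (k : Vertex n) :
    Crosses (rotPair k x) (rotPair k y) ↔ Crosses x y :=
  ⟨fun h => by simpa using h.rotPair (-k), fun h => h.rotPair k⟩

theorem crosses_oppPair {n : ℕ} {x y : Sym2 (Vertex n)} :
    Crosses (oppPair x) (oppPair y) ↔ Crosses x y := by
  rw [oppPair_eq_rotPair, oppPair_eq_rotPair, crosses_rotPair]

theorem IsDiagonal.rotPair {n : ℕ} {x : Sym2 (Vertex n)} (h : IsDiagonal x) (k : Vertex n) :
    IsDiagonal (rotPair k x) := by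
  obtain ⟨a, b, rfl, h1, h2⟩ := h
  have ha := val_add_cases a k
  have hb := val_add_cases b k
  rcases lt_or_ge (a + k) (b + k) with h | h
  · exact ⟨a + k, b + k, rfl, by lia, by lia⟩
  · exact ⟨b + k, a + k, Sym2.eq_swap, by lia, by lia⟩

theorem isDiagonal_rotPair {n : ℕ} {x : Sym2 (Vertex n)} (k : Vertex n) :
    IsDiagonal (rotPair k x) ↔ IsDiagonal x :=
  ⟨fun h => by simpa using h.rotPair (-k), fun h => h.rotPair k⟩

theorem isDiagonal_oppPair {n : ℕ} {x : Sym2 (Vertex n)} :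
    IsDiagonal (oppPair x) ↔ IsDiagonal x := by
  rw [oppPair_eq_rotPair, isDiagonal_rotPair]

/-- A chord and its image under a half-turn are parallel or lie on one line. -/
theorem not_crosses_oppPair {n : ℕ} (x : Sym2 (Vertex n)) : ¬ Crosses x (oppPair x) := by
  intro h
  obtain ⟨a, b, hab, rfl⟩ := h.isDiagonal.exists_lt
  have ha := opp_cases a
  have hb := opp_cases b
  rw [oppPair_mk] at h
  rcases lt_trichotomy (opp a) (opp b) with h' | h' | h'
  · rw [crosses_mk hab h'] at h
    lia
  · lia
  · rw [Sym2.eq_swap (a := opp a), crosses_mk hab h'] at h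
    lia

/-- The image of a centrally symmetric triangulation under the rotation by `-c`. -/
def SymTriangulation.rotate {n : ℕ} (c : Vertex n) (t : SymTriangulation n) :
    SymTriangulation n where
  diagonals := {x | rotPair c x ∈ t.diagonals}
  isTriangulation := by
    rw [isTriangulation_iff]
    intro x
    have h := isTriangulation_iff.1 t.isTriangulation (rotPair c x)
    rw [isDiagonal_rotPair] at h
    refine h.trans (and_congr_right fun _ => ⟨fun h z hz hc => ?_, fun h z hz hc => ?_⟩)
    · exact h _ hz (hc.rotPair c)
    · refine h (rotPair (-c) z) (by simpa using hz) ?_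
      simpa using hc.rotPair (-c)
  symmetric x hx := by
    have := t.symmetric _ hx
    rwa [← rotPair_oppPair] at this

theorem SymTriangulation.mem_rotate {n : ℕ} {c : Vertex n} {t : SymTriangulation n}
    {x : Sym2 (Vertex n)} : x ∈ (t.rotate c).diagonals ↔ rotPair c x ∈ t.diagonals := Iff.rfl

theorem SymTriangulation.rotate_neg_rotate {n : ℕ} (c : Vertex n) (t : SymTriangulation n) :
    (t.rotate c).rotate (-c) = t := by
  ext x
  simp [mem_rotate]

theorem IsFlip.rotate {n : ℕ} {t t' : SymTriangulation n} {x y : Sym2 (Vertex n)}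
    (h : IsFlip t t' x y) (c : Vertex n) :
    IsFlip (t.rotate (-c)) (t'.rotate (-c)) (rotPair c x) (rotPair c y) := by
  obtain ⟨hx, hy, he⟩ := h
  refine ⟨by simpa [SymTriangulation.mem_rotate] using hx,
    by simpa [SymTriangulation.mem_rotate] using hy, ?_⟩
  have key : ∀ z w : Sym2 (Vertex n), rotPair (-c) z = w ↔ z = rotPair c w := fun z w =>
    ⟨fun h => by simp [← h], fun h => by simp [h]⟩
  ext z
  rw [SymTriangulation.mem_rotate, he]
  simp [SymTriangulation.mem_rotate, key, rotPair_oppPair]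

/-! ### Triangles of a triangulation -/

namespace SymTriangulation

/-- No diagonal of `t` crosses `x`, so that `x` is either a side of `K` or a diagonal of `t`. -/
def Uncrossed {n : ℕ} (t : SymTriangulation n) (x : Sym2 (Vertex n)) : Prop :=
  ∀ z ∈ t.diagonals, ¬ Crosses z x

variable {n : ℕ} {t : SymTriangulation n} {x y : Sym2 (Vertex n)}

theorem mem_iff : x ∈ t.diagonals ↔ IsDiagonal x ∧ t.Uncrossed x :=
  isTriangulation_iff.1 t.isTriangulation x

theorem isDiagonal (h : x ∈ t.diagonals) : IsDiagonal x := (mem_iff.1 h).1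

theorem uncrossed (h : x ∈ t.diagonals) : t.Uncrossed x := (mem_iff.1 h).2

theorem oppPair_mem : oppPair x ∈ t.diagonals ↔ x ∈ t.diagonals :=
  ⟨fun h => by simpa [oppPair_oppPair] using t.symmetric _ h, t.symmetric x⟩

theorem Uncrossed.oppPair (h : t.Uncrossed x) : t.Uncrossed (oppPair x) := fun z hz hc =>
  h _ (t.symmetric z hz) (by rwa [← crosses_oppPair, oppPair_oppPair])

theorem Uncrossed.not_crosses (hx : t.Uncrossed x) (hy : t.Uncrossed y) : ¬ Crosses x y :=
  fun h => hy x (mem_iff.2 ⟨h.isDiagonal, hx⟩) h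

theorem uncrossed_of_not_isDiagonal (h : ¬ IsDiagonal x) : t.Uncrossed x :=
  fun _ _ hc => h hc.symm.isDiagonal

/-- An uncrossed chord that is not a side of `K` bounds a triangle of `t` on its left. -/
theorem exists_triangle {p q : Vertex n} (hpq : p.val + 1 < q.val) (h : t.Uncrossed s(p, q)) :
    ∃ r, p < r ∧ r < q ∧ t.Uncrossed s(p, r) ∧ t.Uncrossed s(r, q) := by
  obtain ⟨u, hu⟩ : ∃ u : Vertex n, u.val = p.val + 1 := ⟨⟨_, by lia⟩, rfl⟩
  -- The apex is the last vertex before `q` joined to `p` by an uncrossed chord; the side at `p`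
  -- shows that there is one. A diagonal crossing `s(r, q)` would have to start at `p` and end
  -- beyond `r`.
  obtain ⟨r, ⟨hpr, hrq, hr⟩, hmax⟩ := Set.Finite.exists_maximal
    (Set.toFinite {r : Vertex n | p < r ∧ r < q ∧ t.Uncrossed s(p, r)})
    ⟨u, by lia, by lia, uncrossed_of_not_isDiagonal (by
      rw [isDiagonal_mk (by lia)]; lia)⟩
  refine ⟨r, hpr, hrq, hr, fun z hz hc => ?_⟩
  have hzp := h z hz
  have hzr := hr z hz
  obtain ⟨e, f, hef, rfl⟩ := hc.isDiagonal.exists_lt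
  rw [crosses_mk hef (by lia)] at hc hzp hzr
  have hp : e = p := by lia
  subst hp
  have := hmax (y := f) ⟨by lia, by lia, uncrossed hz⟩ (by lia)
  lia

/-- A centrally symmetric triangulation has a central diagonal. -/
theorem exists_isCentral (t : SymTriangulation n) : ∃ x ∈ t.diagonals, IsCentral x := by
  have central : ∀ p q : Vertex n, q.val = p.val + (n + 2) → t.Uncrossed s(p, q) →
      ∃ x ∈ t.diagonals, IsCentral x := by
    intro p q hpq h
    refine ⟨_, mem_iff.2 ⟨(isDiagonal_mk (by lia)).2 (by lia), h⟩, p, ?_⟩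
    have := opp_cases p
    rw [show q = opp p by lia]
  -- Descent on the length of an uncrossed chord spanning more than half of the boundary: the
  -- triangle on it has a central side or another such long side.
  have key : ∀ k : ℕ, ∀ p q : Vertex n, p.val + k = q.val → n + 2 < k → t.Uncrossed s(p, q) →
      ∃ x ∈ t.diagonals, IsCentral x := by
    intro k
    induction k using Nat.strong_induction_on with
    | _ k ih =>
      intro p q hk hk' h
      obtain ⟨r, hpr, hrq, h1, h2⟩ := exists_triangle (by lia) h
      rcases lt_trichotomy (r.val - p.val) (n + 2) with hr | hr | hr
      · rcases lt_trichotomy (q.val - r.val) (n + 2) with hr' | hr' | hr'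
        -- If both sides are short, the center is inside the triangle, and the opposite of `s(p, r)`
        -- crosses `s(r, q)`.
        · have h3 := h1.oppPair.not_crosses h2
          have hp := opp_cases p
          have hr := opp_cases r
          rw [oppPair_mk] at h3
          rcases lt_or_ge (opp p) (opp r) with hpr' | hpr'
          · rw [crosses_mk hpr' hrq] at h3
            lia
          · rw [Sym2.eq_swap, crosses_mk (by lia) hrq] at h3
            lia
        · exact central r q (by lia) h2
        · exact ih (q.val - r.val) (by lia) r q (by lia) hr' h2
      · exact central p r (by lia) h1
      · exact ih (r.val - p.val) (by lia) p r (by lia) hr h1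
  obtain ⟨z, hz⟩ : ∃ z : Vertex n, z.val = 0 := ⟨⟨_, by lia⟩, rfl⟩
  obtain ⟨l, hl⟩ : ∃ l : Vertex n, l.val = 2 * n + 3 := ⟨⟨_, by lia⟩, rfl⟩
  refine key (2 * n + 3) z l (by lia) (by lia) ?_
  refine uncrossed_of_not_isDiagonal ?_
  rw [isDiagonal_mk (by lia)]
  lia

/-- A triangulation of a `(2n+4)`-gon has at most `2n+1` diagonals. -/
theorem ncard_diagonals_le (t : SymTriangulation n) : t.diagonals.ncard ≤ 2 * n + 1 := by
  obtain ⟨z, hz⟩ : ∃ z : Vertex n, z.val = 0 := ⟨⟨_, by lia⟩, rfl⟩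
  obtain ⟨l, hl⟩ : ∃ l : Vertex n, l.val = 2 * n + 3 := ⟨⟨_, by lia⟩, rfl⟩
  have hside : ¬ IsDiagonal s(z, l) := by
    rw [isDiagonal_mk (by lia)]; lia
  -- Each diagonal, and the side `s(z, l)`, is charged to the apex of the triangle between its end
  -- points. Only `2n+2` vertices can be an apex, and the side uses one of them.
  have apex : ∀ x ∈ insert s(z, l) t.diagonals, ∃ r p q : Vertex n, x = s(p, q) ∧ p < r ∧ r < q ∧
      t.Uncrossed s(p, q) ∧ t.Uncrossed s(p, r) ∧ t.Uncrossed s(r, q) := by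
    rintro x (rfl | hx)
    · have h := uncrossed_of_not_isDiagonal (t := t) hside
      obtain ⟨r, hr⟩ := exists_triangle (by lia) h
      exact ⟨r, z, l, rfl, hr.1, hr.2.1, h, hr.2.2⟩
    · have hx' := isDiagonal hx
      obtain ⟨p, q, hpq, rfl⟩ := hx'.exists_lt
      rw [isDiagonal_mk hpq] at hx'
      obtain ⟨r, hr⟩ := exists_triangle hx'.1 (uncrossed hx)
      exact ⟨r, p, q, rfl, hr.1, hr.2.1, uncrossed hx, hr.2.2⟩
  choose! f p q hf using apex
  -- If two different chords had the same apex, one of them would cross the other or a side of the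
  -- other's triangle.
  have hinj : Set.InjOn f (insert s(z, l) t.diagonals) := by
    intro x hx y hy hxy
    obtain ⟨hx1, hx2, hx3, hx4, hx5, hx6⟩ := hf x hx
    obtain ⟨hy1, hy2, hy3, hy4, hy5, hy6⟩ := hf y hy
    rw [hxy] at hx2 hx3 hx5 hx6
    have c0 := hx4.not_crosses hy4
    have c1 := hx5.not_crosses hy4
    have c2 := hx6.not_crosses hy4
    have c3 := hy5.not_crosses hx4
    have c4 := hy6.not_crosses hx4
    rw [crosses_mk (by lia) (by lia)] at c0 c1 c2 c3 c4
    rw [hx1, hy1, show p x = p y by lia, show q x = q y by lia]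
  have hmaps : Set.MapsTo f (insert s(z, l) t.diagonals) ({z, l}ᶜ) := by
    intro x hx
    obtain ⟨hx1, hx2, hx3, -⟩ := hf x hx
    simp only [Set.mem_compl_iff, Set.mem_insert_iff, Set.mem_singleton_iff]
    lia
  have h1 := Set.ncard_le_ncard_of_injOn f hmaps hinj
  rw [Set.ncard_insert_of_notMem fun h => hside (isDiagonal h)] at h1
  have h2 := Set.ncard_add_ncard_compl ({z, l} : Set (Vertex n))
  rw [Set.ncard_pair (by lia), Nat.card_fin] at h2
  lia

end SymTriangulation

/-! ### Flips -/

/-- The opposite of a chord at `a` contains `a` only if the chord is central, and then it is the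
chord itself. Hence the flip of the opposite diagonal removes no side of the quadrilateral. -/
theorem oppPair_ne {n : ℕ} {a b c : Vertex n} (h : c ≠ b) :
    oppPair s(a, b) ≠ s(a, c) := by
  rw [oppPair_mk, Ne, Sym2.eq_iff]
  rintro (⟨h1, -⟩ | ⟨h1, h2⟩)
  · exact opp_ne _ h1
  · exact h (by rw [← h1, ← h2, opp_opp])

open SymTriangulation in
/-- The diagonal of a quadrilateral formed by two triangles can be flipped. -/
theorem exists_isFlip_of_quadrilateral {n : ℕ} {t : SymTriangulation n} {a p r q : Vertex n}
    (hap : a < p) (hpr : p < r) (hrq : r < q) (hpq : s(p, q) ∈ t.diagonals)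
    (h1 : t.Uncrossed s(a, p)) (h2 : t.Uncrossed s(p, r)) (h3 : t.Uncrossed s(r, q))
    (h4 : t.Uncrossed s(a, q)) : ∃ t', IsFlip t t' s(p, q) s(a, r) := by
  set x := s(p, q) with hx
  set y := s(a, r) with hy
  have hxy : Crosses x y := (crosses_mk (by lia) (by lia)).2 (by lia)
  have hyt : y ∉ t.diagonals := fun h => uncrossed h _ hpq hxy
  have hyt' : oppPair y ∉ t.diagonals := fun h => hyt (oppPair_mem.1 h)
  -- `x` is the only diagonal of `t` that crosses `y`
  have only : ∀ z ∈ t.diagonals, Crosses z y → z = x := by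
    intro z hz hc
    have c1 := h1 z hz
    have c2 := h2 z hz
    have c3 := h3 z hz
    have c4 := h4 z hz
    obtain ⟨e, f, hef, rfl⟩ := hc.isDiagonal.exists_lt
    rw [hy, crosses_mk hef (by lia)] at hc
    rw [crosses_mk hef (by lia)] at c1 c2 c3 c4
    rw [hx, show e = p by lia, show f = q by lia]
  have only' : ∀ z ∈ t.diagonals, Crosses z (oppPair y) → z = oppPair x := by
    intro z hz hc
    rw [← crosses_oppPair, oppPair_oppPair] at hc
    rw [← only _ (t.symmetric z hz) hc, oppPair_oppPair]
  set E := (t.diagonals \ {x, oppPair x}) ∪ {y, oppPair y} with hE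
  have hEsymm : ∀ z ∈ E, oppPair z ∈ E := by
    have key : ∀ z w : Sym2 (Vertex n), oppPair z = w ↔ z = oppPair w := fun z w =>
      ⟨fun h => by rw [← h, oppPair_oppPair], fun h => by rw [h, oppPair_oppPair]⟩
    simp only [hE, Set.mem_union, Set.mem_sdiff, Set.mem_insert_iff, Set.mem_singleton_iff,
      oppPair_mem, key, oppPair_oppPair]
    tauto
  have hyd : IsDiagonal y := hxy.symm.isDiagonal
  have hnc : ∀ z ∈ E, ¬ Crosses z y := by
    rintro z (⟨hz, hz'⟩ | rfl | hz) hc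
    · exact hz' (Or.inl (only z hz hc))
    · exact not_crosses_self _ hc
    · rw [show z = oppPair y from hz] at hc
      exact not_crosses_oppPair _ hc.symm
  have hnc' : ∀ z ∈ E, ¬ Crosses z (oppPair y) := by
    intro z hz hc
    refine hnc _ (hEsymm z hz) ?_
    rwa [← crosses_oppPair, oppPair_oppPair]
  -- the sides of the quadrilateral are not affected by the flip
  have side : ∀ s, t.Uncrossed s → s ≠ x → s ≠ oppPair x → ∀ w, (∀ z ∈ E, ¬ Crosses z w) →
      ¬ Crosses w s := fun s hs hs1 hs2 w hw hc =>
    hw s (Or.inl ⟨mem_iff.2 ⟨hc.symm.isDiagonal, hs⟩, by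
      simp only [Set.mem_insert_iff, Set.mem_singleton_iff]; tauto⟩) hc.symm
  -- A chord that crosses `x` but no side of the quadrilateral must run between the other two
  -- corners.
  have max_x : ∀ w, IsDiagonal w → (∀ z ∈ E, ¬ Crosses z w) → Crosses w x → w = y := by
    intro w hw hwE hc
    have hne : ∀ {u v w : Vertex n}, u < v → v < w → s(u, v) ≠ s(v, w) := by
      intro u v w h1 h2 h
      rw [Sym2.eq_iff] at h
      lia
    have c1 := side _ h1 (hne hap (by lia))
      (fun h => oppPair_ne (a := p) (b := q) (c := a) (by lia) (by rw [← hx, ← h, Sym2.eq_swap]))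
      w hwE
    have c2 := side _ h2 (fun h => by rw [hx, Sym2.eq_iff] at h; lia)
      (fun h => oppPair_ne (a := p) (b := q) (c := r) (by lia) (by rw [← hx, ← h])) w hwE
    have c3 := side _ h3 (fun h => by rw [hx, Sym2.eq_iff] at h; lia)
      (fun h => oppPair_ne (a := q) (b := p) (c := r) (by lia)
        (by rw [Sym2.eq_swap, ← hx, ← h, Sym2.eq_swap])) w hwE
    have c4 := side _ h4 (fun h => by rw [hx, Sym2.eq_iff] at h; lia)
      (fun h => oppPair_ne (a := q) (b := p) (c := a) (by lia)
        (by rw [Sym2.eq_swap, ← hx, ← h, Sym2.eq_swap])) w hwE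
    obtain ⟨e, f, hef, rfl⟩ := hw.exists_lt
    rw [hx, crosses_mk hef (by lia)] at hc
    rw [crosses_mk hef (by lia)] at c1 c2 c3 c4
    rw [hy, show e = a by lia, show f = r by lia]
  have hyE : y ∈ E := Or.inr (Or.inl rfl)
  refine ⟨⟨E, isTriangulation_iff.2 fun w => ⟨fun hw => ?_, fun ⟨hw, hwE⟩ => ?_⟩, hEsymm⟩,
    hpq, hyt, rfl⟩
  · rcases hw with ⟨hw, hw'⟩ | rfl | hw
    · refine ⟨isDiagonal hw, ?_⟩
      rintro z (⟨hz, -⟩ | rfl | hz)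
      · exact uncrossed hw z hz
      · exact fun hc => hw' (Or.inl (only w hw hc.symm))
      · rw [show z = oppPair y from hz]
        exact fun hc => hw' (Or.inr (only' w hw hc.symm))
    · exact ⟨hyd, hnc⟩
    · rw [show w = oppPair y from hw]
      exact ⟨isDiagonal_oppPair.2 hyd, hnc'⟩
  -- Maximality of `E`: a compatible `w` is `y` if it crosses `x`, and `oppPair y` if it crosses
  -- `oppPair x`; otherwise it already belongs to `t`, and it is neither `x` nor `oppPair x` since
  -- these cross `y` and `oppPair y`.
  · by_cases hc : Crosses w x
    · rw [max_x w hw hwE hc]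
      exact hyE
    by_cases hc' : Crosses w (oppPair x)
    · rw [← crosses_oppPair, oppPair_oppPair] at hc'
      have := max_x _ (isDiagonal_oppPair.2 hw) (fun z hz h => hwE _ (hEsymm z hz) (by
        rwa [← crosses_oppPair, oppPair_oppPair])) hc'
      rw [← oppPair_oppPair w, this]
      exact hEsymm y hyE
    refine Or.inl ⟨mem_iff.2 ⟨hw, fun z hz h => ?_⟩, ?_⟩
    · by_cases hz' : z ∈ ({x, oppPair x} : Set _)
      · rcases hz' with rfl | hz'
        · exact hc h.symm
        · rw [show z = oppPair x from hz'] at h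
          exact hc' h.symm
      · exact hwE z (Or.inl ⟨hz, hz'⟩) h
    · rintro (rfl | h)
      · exact hwE y hyE hxy.symm
      · rw [show w = oppPair x from h] at hwE
        exact hwE _ (hEsymm y hyE) (crosses_oppPair.2 hxy.symm)

open SymTriangulation in
-- Take the widest diagonal `s(p, q)` that crosses `s(0, b)`. A diagonal crossing `s(0, p)` or `s(0,
-- q)` would enclose it and be a wider one, so `0, p, r, q` is a quadrilateral of `t`, where `r` is
-- the apex over `s(p, q)`.
theorem exists_isFlip_of_crosses_zero {n : ℕ} {t : SymTriangulation n} {b : Vertex n}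
    (hb : IsDiagonal s(0, b)) (hbt : s(0, b) ∉ t.diagonals) :
    ∃ t' x r, IsFlip t t' x s(0, r) ∧ Crosses x s(0, b) := by
  have h0 : ((0 : Vertex n)).val = 0 := rfl
  have hb0 : 0 < b := by
    obtain ⟨u, v, huv, h1, h2⟩ := hb
    rw [Sym2.eq_iff] at huv
    lia
  have hne : {v : Vertex n × Vertex n | s(v.1, v.2) ∈ t.diagonals ∧ 0 < v.1 ∧ v.1 < b ∧
      b < v.2}.Nonempty := by
    by_contra hne
    rw [Set.not_nonempty_iff_eq_empty] at hne
    refine hbt (mem_iff.2 ⟨hb, fun z hz hc => ?_⟩)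
    obtain ⟨p, q, hpq, rfl⟩ := hc.isDiagonal.exists_lt
    rw [crosses_mk hpq hb0] at hc
    exact (hne.subset (show (p, q) ∈ _ from ⟨hz, by lia, by lia, by lia⟩))
  obtain ⟨⟨p, q⟩, ⟨hpq, hp0, hpb, hbq⟩, hmax⟩ := Set.exists_max_image _
    (fun v : Vertex n × Vertex n => v.2.val - v.1.val) (Set.toFinite _) hne
  simp only [Set.mem_ofPred_eq, Prod.forall] at hpq hp0 hpb hbq hmax
  obtain ⟨r, hpr, hrq, h2, h3⟩ := exists_triangle (by lia) (uncrossed hpq)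
  have h1 : t.Uncrossed s(0, p) := by
    intro z hz hc
    have hz' := uncrossed hpq z hz
    obtain ⟨e, f, hef, rfl⟩ := hc.isDiagonal.exists_lt
    rw [crosses_mk hef (by lia)] at hz' hc
    have := hmax e f
    simp only [hz, true_and] at this
    lia
  have h4 : t.Uncrossed s(0, q) := by
    intro z hz hc
    have hz' := uncrossed hpq z hz
    obtain ⟨e, f, hef, rfl⟩ := hc.isDiagonal.exists_lt
    rw [crosses_mk hef (by lia)] at hz' hc
    have := hmax e f
    simp only [hz, true_and] at this
    lia
  obtain ⟨t', ht'⟩ := exists_isFlip_of_quadrilateral hp0 hpr hrq hpq h1 h2 h3 h4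
  exact ⟨t', _, r, ht', (crosses_mk (by lia) hb0).2 (by lia)⟩

/-- If `s(a, b)` is not in `t`, some diagonal that crosses it can be flipped to a diagonal with
end point `a`. -/
theorem exists_isFlip_of_crosses {n : ℕ} {t : SymTriangulation n} {a b : Vertex n}
    (hb : IsDiagonal s(a, b)) (hbt : s(a, b) ∉ t.diagonals) :
    ∃ t' x r, IsFlip t t' x s(a, r) ∧ Crosses x s(a, b) := by
  have e : rotPair a s(0, b - a) = s(a, b) := by simp
  obtain ⟨t', x, r, h, hc⟩ := exists_isFlip_of_crosses_zero (t := t.rotate a) (b := b - a)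
    (by rwa [← isDiagonal_rotPair a, e]) (by rwa [SymTriangulation.mem_rotate, e])
  have h' := h.rotate a
  rw [SymTriangulation.rotate_neg_rotate, rotPair_mk, zero_add] at h'
  exact ⟨_, _, _, h', by rw [← e]; exact hc.rotPair a⟩

/-! ### Central diagonals -/

theorem IsCentral.exists_val_eq {n : ℕ} {x : Sym2 (Vertex n)} (h : IsCentral x) :
    ∃ a b : Vertex n, x = s(a, b) ∧ b.val = a.val + (n + 2) := by
  obtain ⟨a, rfl⟩ := h
  rcases opp_cases a with h | h
  · exact ⟨a, opp a, rfl, h.2⟩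
  · exact ⟨opp a, a, Sym2.eq_swap, by lia⟩

theorem IsCentral.oppPair_eq {n : ℕ} {x : Sym2 (Vertex n)} (h : IsCentral x) : oppPair x = x := by
  obtain ⟨a, rfl⟩ := h
  rw [oppPair_mk, opp_opp, Sym2.eq_swap]

theorem isCentral_of_oppPair_eq {n : ℕ} {x : Sym2 (Vertex n)} (hx : oppPair x = x) :
    IsCentral x := by
  induction x with | _ a b =>
  rw [oppPair_mk, Sym2.eq_iff] at hx
  rcases hx with hx | hx
  · exact absurd hx.1 (opp_ne a)
  · exact ⟨a, by rw [hx.1]⟩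

theorem isCentral_oppPair {n : ℕ} {x : Sym2 (Vertex n)} : IsCentral (oppPair x) ↔ IsCentral x := by
  constructor
  · intro h
    have := h.oppPair_eq
    rw [oppPair_oppPair] at this
    rwa [this]
  · intro h
    rwa [h.oppPair_eq]

theorem IsCentral.eq_of_not_crosses {n : ℕ} {x y : Sym2 (Vertex n)} (hx : IsCentral x)
    (hy : IsCentral y) (h : ¬ Crosses x y) : x = y := by
  obtain ⟨a, b, rfl, hab⟩ := hx.exists_val_eq
  obtain ⟨c, d, rfl, hcd⟩ := hy.exists_val_eq
  rw [crosses_mk (by lia) (by lia)] at h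
  rw [show a = c by lia, show b = d by lia]

theorem SymTriangulation.eq_of_isCentral {n : ℕ} {t : SymTriangulation n} {x y : Sym2 (Vertex n)}
    (hx : x ∈ t.diagonals) (hy : y ∈ t.diagonals) (hxc : IsCentral x) (hyc : IsCentral y) :
    x = y :=
  hxc.eq_of_not_crosses hyc (t.uncrossed hy x hx)

/-! ### Connectivity of the flip graph -/

theorem not_crosses_of_common_vertex {n : ℕ} (a b c : Vertex n) : ¬ Crosses s(a, b) s(a, c) := by
  rintro ⟨a', b', c', d', h1, h2, h3, ⟨hx, hy⟩ | ⟨hx, hy⟩⟩ <;>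
    rw [Sym2.eq_iff] at hx hy <;> lia

/-- If `s(a, b)` and `s(a, r)` do not cross a central diagonal, of which `a` is not an end point,
then they lie on the same side of it. -/
theorem not_crosses_oppPair_of_isCentral {n : ℕ} {a b r : Vertex n} {z : Sym2 (Vertex n)}
    (hz : IsCentral z) (haz : a ∉ z) (hab : a ≠ b) (har : a ≠ r)
    (hb : ¬ Crosses s(a, b) z) (hr : ¬ Crosses s(a, r) z) :
    ¬ Crosses (oppPair s(a, r)) s(a, b) := by
  obtain ⟨u, v, rfl, huv⟩ := hz.exists_val_eq
  have hau : a ≠ u ∧ a ≠ v := by simpa using haz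
  intro h
  have ha' := opp_cases a
  have hr' := opp_cases r
  rw [oppPair_mk] at h
  have huv' : u < v := by lia
  -- All chords are oriented increasingly, so that crossing becomes linear inequalities.
  rcases lt_or_gt_of_ne hab with h1 | h1 <;> rcases lt_or_gt_of_ne har with h2 | h2 <;>
  rcases lt_or_gt_of_ne (show opp a ≠ opp r by lia) with h3 | h3 <;>
  first
  | rw [crosses_mk h1 huv'] at hb
  | rw [Sym2.eq_swap, crosses_mk h1 huv'] at hb
  all_goals first
  | rw [crosses_mk h2 huv'] at hr
  | rw [Sym2.eq_swap, crosses_mk h2 huv'] at hr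
  all_goals first
  | rw [crosses_mk h3 h1] at h
  | rw [Sym2.eq_swap (a := opp a), crosses_mk h3 h1] at h
  | rw [Sym2.eq_swap (a := a) (b := b), crosses_mk h3 h1] at h
  | rw [Sym2.eq_swap (a := opp a), Sym2.eq_swap (a := a) (b := b), crosses_mk h3 h1] at h
  all_goals lia (splits := 24)

/-- `v` contains `D` and is obtained from `u` by a flip. -/
def FlipStep {n : ℕ} (D : Set (Sym2 (Vertex n))) (u v : SymTriangulation n) : Prop :=
  D ⊆ v.diagonals ∧ ∃ x y, IsFlip u v x y

theorem subset_of_reflTransGen_flipStep {n : ℕ} {D : Set (Sym2 (Vertex n))}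
    {t t' : SymTriangulation n} (h : Relation.ReflTransGen (FlipStep D) t t')
    (hD : D ⊆ t.diagonals) : D ⊆ t'.diagonals := by
  cases h with
  | refl => exact hD
  | tail _ h => exact h.1

theorem IsFlip.subset {n : ℕ} {t t' : SymTriangulation n} {x y : Sym2 (Vertex n)}
    (h : IsFlip t t' x y) {D : Set (Sym2 (Vertex n))} (hD : D ⊆ t.diagonals)
    (hDsymm : ∀ z ∈ D, oppPair z ∈ D) (hx : x ∉ D) : D ⊆ t'.diagonals := by
  rw [h.2.2]
  intro z hz
  refine Or.inl ⟨hD hz, ?_⟩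
  rintro (rfl | hz')
  · exact hx hz
  · have := hDsymm z hz
    rw [show z = oppPair x from hz', oppPair_oppPair] at this
    exact hx this

open SymTriangulation in
-- Induction on the number of diagonals crossing `y`. A flip replaces one of them by a diagonal
-- sharing an end point with `y`; the only danger is that the opposite new diagonal crosses `y`. It
-- does not if `y` is central, and otherwise a central diagonal in `D` separates the two.
theorem exists_reflTransGen_flipStep_mem {n : ℕ} {D : Set (Sym2 (Vertex n))}
    {y : Sym2 (Vertex n)} (hDsymm : ∀ z ∈ D, oppPair z ∈ D) (hDy : ∀ z ∈ D, ¬ Crosses z y)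
    (hy : IsDiagonal y) (hyc : IsCentral y ∨ ∃ z ∈ D, IsCentral z)
    (t : SymTriangulation n) (hD : D ⊆ t.diagonals) :
    ∃ t', Relation.ReflTransGen (FlipStep D) t t' ∧ y ∈ t'.diagonals := by
  induction hk : {x ∈ t.diagonals | Crosses x y}.ncard using Nat.strong_induction_on
    generalizing t with
  | _ k ih =>
    by_cases hyt : y ∈ t.diagonals
    · exact ⟨t, .refl, hyt⟩
    -- The end point `a` is chosen off the central diagonal `z`; if both end points were on it, `y`
    -- would be `z`, which is in `t`.
    obtain ⟨a, b, rfl, hab⟩ : ∃ a b, y = s(a, b) ∧ (IsCentral y ∨ ∃ z ∈ D, IsCentral z ∧ a ∉ z) := by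
      obtain ⟨a, b, hab, rfl⟩ := hy.exists_lt
      rcases hyc with hyc | ⟨z, hz, hzc⟩
      · exact ⟨a, b, rfl, Or.inl hyc⟩
      · by_cases haz : a ∈ z
        · refine ⟨b, a, Sym2.eq_swap, Or.inr ⟨z, hz, hzc, fun hbz => hyt ?_⟩⟩
          rw [← ((Sym2.mem_and_mem_iff (by lia)).1 ⟨haz, hbz⟩)]
          exact hD hz
        · exact ⟨a, b, rfl, Or.inr ⟨z, hz, hzc, haz⟩⟩
    obtain ⟨t', x, r, hf, hc⟩ := exists_isFlip_of_crosses hy hyt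
    have hD' : D ⊆ t'.diagonals := hf.subset hD hDsymm fun hx => hDy x hx hc
    have hr : s(a, r) ∈ t'.diagonals := hf.symm.1
    have hopp : ¬ Crosses (oppPair s(a, r)) s(a, b) := by
      rcases hab with hyc | ⟨z, hz, hzc, haz⟩
      · rw [← hyc.oppPair_eq, crosses_oppPair]
        exact not_crosses_of_common_vertex a r b
      · have ne : ∀ {c : Vertex n}, IsDiagonal s(a, c) → a ≠ c := by
          rintro c ⟨a', b', h, h'⟩ rfl
          rw [Sym2.eq_iff] at h
          lia
        exact not_crosses_oppPair_of_isCentral hzc haz (ne hy) (ne (t'.isDiagonal hr))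
          (fun h => hDy z hz h.symm) (uncrossed (hD' hz) _ hr)
    obtain ⟨t'', h1, h2⟩ := ih _ (by
      rw [← hk]
      refine Set.ncard_lt_ncard ?_ (Set.toFinite _)
      rw [Set.ssubset_iff_exists]
      refine ⟨?_, x, ⟨hf.1, hc⟩, fun h => hf.symm.2.1 h.1⟩
      rintro w ⟨hw, hwc⟩
      rw [hf.2.2] at hw
      rcases hw with hw | rfl | hw
      · exact ⟨hw.1, hwc⟩
      · exact absurd hwc (not_crosses_of_common_vertex a r b)
      · rw [show w = _ from hw] at hwc
        exact absurd hwc hopp) t' hD' rfl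
    exact ⟨t'', .head ⟨hD', _, _, hf⟩ h1, h2⟩

theorem SymTriangulation.eq_of_subset {n : ℕ} {s t : SymTriangulation n}
    (h : s.diagonals ⊆ t.diagonals) : t = s := by
  refine SymTriangulation.ext (Set.Subset.antisymm (fun x hx => ?_) h)
  exact mem_iff.2 ⟨isDiagonal hx, fun z hz => uncrossed hx z (h hz)⟩

/-- Two centrally symmetric triangulations are connected by flips keeping their common
diagonals. -/
theorem reflTransGen_flipStep {n : ℕ} (s t : SymTriangulation n) :
    Relation.ReflTransGen (FlipStep (t.diagonals ∩ s.diagonals)) t s := by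
  induction hk : (s.diagonals \ t.diagonals).ncard using Nat.strong_induction_on
    generalizing t with
  | _ k ih =>
    by_cases hst : s.diagonals ⊆ t.diagonals
    · rw [SymTriangulation.eq_of_subset hst]
    -- The central diagonal of `s` is inserted first; once it is common to both, any missing
    -- diagonal will do.
    obtain ⟨y, hys, hyt, hyc⟩ : ∃ y ∈ s.diagonals, y ∉ t.diagonals ∧
        (IsCentral y ∨ ∃ z ∈ t.diagonals ∩ s.diagonals, IsCentral z) := by
      obtain ⟨z, hz, hzc⟩ := s.exists_isCentral
      by_cases hzt : z ∈ t.diagonals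
      · obtain ⟨y, hys, hyt⟩ := Set.not_subset.1 hst
        exact ⟨y, hys, hyt, Or.inr ⟨z, ⟨hzt, hz⟩, hzc⟩⟩
      · exact ⟨z, hz, hzt, Or.inl hzc⟩
    obtain ⟨t', h1, h2⟩ := exists_reflTransGen_flipStep_mem
      (D := t.diagonals ∩ s.diagonals) (fun z hz => ⟨t.symmetric z hz.1, s.symmetric z hz.2⟩)
      (fun z hz => SymTriangulation.uncrossed hys z hz.2) (s.isDiagonal hys) hyc t
      Set.inter_subset_left
    have hD := subset_of_reflTransGen_flipStep h1 Set.inter_subset_left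
    have h3 := ih _ (by
      rw [← hk]
      refine Set.ncard_lt_ncard ?_ (Set.toFinite _)
      rw [Set.ssubset_iff_exists]
      refine ⟨fun z hz => ⟨hz.1, fun hzt => hz.2 (hD ⟨hzt, hz.1⟩)⟩, y, ⟨hys, hyt⟩, fun h => h.2 h2⟩)
      t' rfl
    refine h1.trans (Relation.ReflTransGen.mono ?_ _ _ h3)
    rintro u v ⟨h, hf⟩
    exact ⟨fun z hz => h ⟨hD hz, hz.2⟩, hf⟩

/-! ### Colorings -/

/-- The non-central diagonals form opposite pairs of two distinct elements; as there are at most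
`2n+1` diagonals, there are at most `n` pairs. -/
theorem SymTriangulation.exists_coloring {n : ℕ} (t : SymTriangulation n) :
    ∃ T : ColoredTriangulation n, T.supp = t := by
  classical
  set A : Finset (Sym2 (Vertex n)) := {x | x ∈ t.diagonals ∧ ¬ IsCentral x} with hA
  have memA : ∀ {x}, x ∈ A ↔ x ∈ t.diagonals ∧ ¬ IsCentral x := by simp [hA]
  set g : Sym2 (Vertex n) → Sym2 (Sym2 (Vertex n)) := fun x => s(x, oppPair x) with hg
  have hgg : ∀ x y, g x = g y ↔ y = x ∨ y = oppPair x := by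
    intro x y
    rw [hg]
    simp only [Sym2.eq_iff]
    constructor
    · rintro (h | h)
      · exact Or.inl h.1.symm
      · exact Or.inr h.2.symm
    · rintro (rfl | rfl)
      · exact Or.inl ⟨rfl, rfl⟩
      · exact Or.inr ⟨(oppPair_oppPair x).symm, rfl⟩
  have hcard : (A.image g).card * 2 ≤ A.card := by
    rw [Finset.card_eq_sum_card_image g A]
    rw [← smul_eq_mul]
    refine Finset.card_nsmul_le_sum _ _ 2 fun b hb => ?_
    obtain ⟨x, hx, rfl⟩ := Finset.mem_image.1 hb
    have hx' := memA.1 hx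
    have hne : x ≠ oppPair x := fun h => hx'.2 (isCentral_of_oppPair_eq h.symm)
    refine (Finset.card_pair hne).symm.le.trans (Finset.card_le_card ?_)
    intro y hy
    rw [Finset.mem_insert, Finset.mem_singleton] at hy
    rw [Finset.mem_filter, eq_comm, hgg]
    refine ⟨memA.2 ?_, hy⟩
    rcases hy with rfl | rfl
    · exact hx'
    · exact ⟨t.symmetric x hx'.1, fun h => hx'.2 (isCentral_oppPair.1 h)⟩
  have hcard' : A.card ≤ 2 * n + 1 := by
    refine le_trans ?_ t.ncard_diagonals_le
    rw [← Set.ncard_coe_finset]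
    exact Set.ncard_le_ncard (fun x hx => (memA.1 hx).1)
  obtain ⟨e⟩ : Nonempty (A.image g ↪ Fin n) :=
    Function.Embedding.nonempty_of_card_le (by rw [Fintype.card_coe, Fintype.card_fin]; lia)
  refine ⟨⟨t, fun x => if h : x ∈ A then some (e ⟨g x, Finset.mem_image_of_mem g h⟩) else none,
    fun x => ?_, fun x hx y hy hxc hyc => ?_⟩, rfl⟩
  · rw [← memA]
    split_ifs with h <;> simp [h]
  · rw [dif_pos (memA.2 ⟨hx, hxc⟩), dif_pos (memA.2 ⟨hy, hyc⟩), Option.some_inj,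
      e.injective.eq_iff, Subtype.mk_eq_mk, hgg]

namespace ColoredTriangulation

variable {n : ℕ} {T S : ColoredTriangulation n} {x y : Sym2 (Vertex n)}

theorem color_oppPair (hx : x ∈ T.supp.diagonals) : T.color (oppPair x) = T.color x := by
  by_cases h : IsCentral x
  · rw [h.oppPair_eq]
  · exact ((T.color_eq_iff x hx _ (T.supp.symmetric x hx) h (by rwa [isCentral_oppPair])).2
      (Or.inr rfl)).symm

theorem eq_or_eq_oppPair_of_color_eq (hx : x ∈ T.supp.diagonals) (hy : y ∈ T.supp.diagonals)
    (h : T.color x = T.color y) : y = x ∨ y = oppPair x := by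
  have h1 := T.isSome_color_iff x
  have h2 := T.isSome_color_iff y
  rw [← h] at h2
  by_cases hxc : IsCentral x <;> by_cases hyc : IsCentral y
  · exact Or.inl (T.supp.eq_of_isCentral hy hx hyc hxc)
  · tauto
  · tauto
  · exact (T.color_eq_iff x hx y hy hxc hyc).1 h

/-- Both colorings have the opposite pairs as color classes, so matching colors is injective on
those in use and extends to a permutation. -/
theorem exists_smul_eq (h : T.supp = S.supp) : ∃ σ : Equiv.Perm (Fin n), σ • T = S := by
  have some_iff : ∀ x, (T.color x).isSome ↔ (S.color x).isSome := by
    intro x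
    rw [T.isSome_color_iff, S.isSome_color_iff, h]
  have eq_iff : ∀ x y, (T.color x).isSome → (T.color y).isSome →
      (T.color x = T.color y ↔ S.color x = S.color y) := by
    intro x y hx hy
    rw [T.isSome_color_iff] at hx hy
    rw [T.color_eq_iff x hx.1 y hy.1 hx.2 hy.2]
    rw [h] at hx hy
    rw [S.color_eq_iff x hx.1 y hy.1 hx.2 hy.2]
  have hex : ∀ c : Fin n, ∃ d : Fin n, ∀ x, T.color x = some c → S.color x = some d := by
    intro c
    by_cases hc : ∃ x, T.color x = some c
    · obtain ⟨x, hx⟩ := hc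
      obtain ⟨d, hd⟩ := Option.isSome_iff_exists.1 ((some_iff x).1 (by simp [hx]))
      refine ⟨d, fun y hy => ?_⟩
      rw [← (eq_iff x y (by simp [hx]) (by simp [hy])).1 (hx.trans hy.symm), hd]
    -- The value at an unused color is arbitrary.
    · exact ⟨c, fun x hx => absurd ⟨x, hx⟩ hc⟩
  choose f hf using hex
  obtain ⟨e, he⟩ := Set.MapsTo.exists_equiv_extend_of_card_eq (t := (Finset.univ : Finset (Fin n)))
    (by simp) (s := {c | ∃ x, T.color x = some c}) (f := f) (fun _ _ => by simp) (by
      rintro c ⟨x, hx⟩ d ⟨y, hy⟩ hcd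
      have := (eq_iff x y (by simp [hx]) (by simp [hy])).2 (by rw [hf c x hx, hf d y hy, hcd])
      rwa [hx, hy, Option.some_inj] at this)
  refine ⟨e.trans (Equiv.subtypeUnivEquiv fun _ => Finset.mem_univ _),
    ColoredTriangulation.ext h (funext fun x => ?_)⟩
  change (T.color x).map _ = S.color x
  cases hx : T.color x with
  | none =>
    have := some_iff x
    rw [hx] at this
    exact (Option.not_isSome_iff_eq_none.1 fun h' => by simp [h'] at this).symm
  | some c =>
    rw [hf c x hx, ← he c ⟨x, hx⟩]
    rfl

/-- A flip of the underlying triangulation lifts to a color preserving flip. -/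
theorem exists_isColoredFlip (T : ColoredTriangulation n) {t' : SymTriangulation n}
    (h : IsFlip T.supp t' x y) :
    ∃ T' : ColoredTriangulation n, T'.supp = t' ∧ IsColoredFlip (T.color x) T T' := by
  classical
  -- The new triangulation has a central diagonal, and the only old one was removed, so it is among
  -- the new diagonals.
  have central : ∀ {t t' : SymTriangulation n} {x y : Sym2 (Vertex n)}, IsFlip t t' x y →
      IsCentral x → IsCentral y := by
    intro t t' x y h hx
    obtain ⟨w, hw, hwc⟩ := t'.exists_isCentral
    rw [h.2.2] at hw
    rcases hw with ⟨hw, hw'⟩ | rfl | hw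
    · exact absurd (t.eq_of_isCentral hw h.1 hwc hx) fun e => hw' (Or.inl e)
    · exact hwc
    · rw [show w = oppPair y from hw] at hwc
      exact isCentral_oppPair.1 hwc
  have hcen : IsCentral x ↔ IsCentral y := ⟨central h, central h.symm⟩
  have hyt' : y ∈ t'.diagonals := h.symm.1
  have hyt'' : oppPair y ∈ t'.diagonals := t'.symmetric y hyt'
  have hyt : oppPair y ∉ T.supp.diagonals := fun hy => h.2.1 (SymTriangulation.oppPair_mem.1 hy)
  have mem_old : ∀ {z}, z ∈ t'.diagonals → ¬ (z = y ∨ z = oppPair y) →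
      z ∈ T.supp.diagonals ∧ ¬ (z = x ∨ z = oppPair x) := by
    intro z hz hz'
    rw [h.2.2] at hz
    exact hz.resolve_right hz'
  have symm_new : ∀ {z}, (oppPair z = y ∨ oppPair z = oppPair y) ↔ (z = y ∨ z = oppPair y) := by
    intro z
    constructor
    · rintro (e | e)
      · exact Or.inr (by rw [← e, oppPair_oppPair])
      · exact Or.inl (by rw [← oppPair_oppPair z, e, oppPair_oppPair])
    · rintro (rfl | rfl)
      · exact Or.inr rfl
      · exact Or.inl (oppPair_oppPair _)
  have color_x_ne : ∀ {z}, z ∈ t'.diagonals → ¬ (z = y ∨ z = oppPair y) →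
      T.color x ≠ T.color z := fun hz hz' e =>
    (mem_old hz hz').2 (eq_or_eq_oppPair_of_color_eq h.1 (mem_old hz hz').1 e)
  refine ⟨⟨t', fun z => if z = y ∨ z = oppPair y then T.color x else
    if z ∈ t'.diagonals then T.color z else none, fun z => ?_, fun z hz w hw hzc hwc => ?_⟩, rfl,
    x, y, h, rfl, by simp, fun z hz hz' => ?_⟩
  · split_ifs with h1 h2
    · have : z ∈ t'.diagonals ∧ (IsCentral z ↔ IsCentral x) := by
        rcases h1 with rfl | rfl
        · exact ⟨hyt', hcen.symm⟩
        · exact ⟨hyt'', by rw [isCentral_oppPair, hcen]⟩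
      rw [T.isSome_color_iff, this.2]
      simp [h.1, this.1]
    · rw [T.isSome_color_iff]
      simp [h2, (mem_old h2 h1).1]
    · simp [h2]
  · by_cases h1 : z = y ∨ z = oppPair y <;> by_cases h2 : w = y ∨ w = oppPair y
    · simp only [if_pos h1, if_pos h2, true_iff]
      rcases h1 with rfl | rfl
      · exact h2
      · rw [oppPair_oppPair]
        exact h2.symm
    · simp only [if_pos h1, if_neg h2, if_pos hw, color_x_ne hw h2, false_iff]
      rintro (rfl | rfl)
      · exact h2 h1
      · exact h2 (symm_new.2 h1)
    · simp only [if_neg h1, if_pos h2, if_pos hz, (color_x_ne hz h1).symm, false_iff]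
      rintro (rfl | rfl)
      · exact h1 h2
      · exact h1 (symm_new.1 h2)
    · simp only [if_neg h1, if_neg h2, if_pos hz, if_pos hw]
      exact T.color_eq_iff z (mem_old hz h1).1 w (mem_old hw h2).1 hzc hwc
  · have : ¬ (z = y ∨ z = oppPair y) := by
      rintro (rfl | rfl)
      · exact h.2.1 hz
      · exact hyt hz
    simp only [if_neg this, if_pos hz']

end ColoredTriangulation

/-! ### The faces of the colorful cyclohedron -/

/-- The diagonals that all vertices of the face `(C, T)` share. -/
def fixedDiagonals {n : ℕ} (C : Set (Option (Fin n))) (T : ColoredTriangulation n) :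
    Set (Sym2 (Vertex n)) :=
  {x | x ∈ T.supp.diagonals ∧ T.color x ∉ C}

theorem faceVertices_eq_of_mem {n : ℕ} {C : Set (Option (Fin n))} {T S : ColoredTriangulation n}
    (h : S ∈ faceVertices C T) : faceVertices C T = faceVertices C S := by
  have h : (exchangeGraph C).Reachable T S := h
  exact Set.ext fun R => ⟨h.symm.trans, h.trans⟩

theorem self_mem_faceVertices {n : ℕ} (C : Set (Option (Fin n))) (T : ColoredTriangulation n) :
    T ∈ faceVertices C T := SimpleGraph.Reachable.refl _

theorem faceVertices_induction {n : ℕ} {C : Set (Option (Fin n))} {T : ColoredTriangulation n}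
    {p : ColoredTriangulation n → Prop} (h0 : p T)
    (h1 : ∀ R S c, R ∈ faceVertices C T → c ∈ C → IsColoredFlip c R S → p R → p S) :
    ∀ S ∈ faceVertices C T, p S := by
  intro S hS'
  have hS := (SimpleGraph.reachable_iff_reflTransGen _ _).1
    (show (exchangeGraph C).Reachable T S from hS')
  clear hS'
  induction hS with
  | refl => exact h0
  | tail hab hbc ih =>
    obtain ⟨c, hc, h⟩ := hbc
    exact h1 _ _ c ((SimpleGraph.reachable_iff_reflTransGen _ _).2 hab) hc h ih

theorem mem_faceVertices_of_isColoredFlip {n : ℕ} {C : Set (Option (Fin n))} {c : Option (Fin n)}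
    {T R S : ColoredTriangulation n} (hR : R ∈ faceVertices C T) (hc : c ∈ C)
    (h : IsColoredFlip c R S) : S ∈ faceVertices C T :=
  SimpleGraph.Reachable.trans (show (exchangeGraph C).Reachable T R from hR)
    (SimpleGraph.Adj.reachable ⟨c, hc, h⟩)

/-- A flip with color in `C` removes only diagonals of that color and keeps the other colors; the
reverse flip gives the other inclusion. -/
theorem fixedDiagonals_eq_of_mem {n : ℕ} {C : Set (Option (Fin n))}
    {T S : ColoredTriangulation n} (hS : S ∈ faceVertices C T) :
    fixedDiagonals C S = fixedDiagonals C T := by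
  have step : ∀ R S : ColoredTriangulation n, ∀ c ∈ C, IsColoredFlip c R S →
      fixedDiagonals C R ⊆ fixedDiagonals C S := by
    rintro R S c hc ⟨x, y, hf, hx, hy, hz⟩ z ⟨hzR, hzC⟩
    have hzS : z ∈ S.supp.diagonals := by
      rw [hf.2.2]
      refine Or.inl ⟨hzR, ?_⟩
      rintro (rfl | h)
      · exact hzC (hx ▸ hc)
      · rw [show z = oppPair x from h, R.color_oppPair hf.1, hx] at hzC
        exact hzC hc
    exact ⟨hzS, by rwa [hz z hzR hzS]⟩
  refine faceVertices_induction (p := fun S => fixedDiagonals C S = fixedDiagonals C T) rfl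
    (fun R S c _ hc h hR => ?_) S hS
  rw [← hR]
  exact Set.Subset.antisymm (step _ _ c hc h.symm) (step _ _ c hc h)

/-- The underlying triangulations of the vertices of the face `(C, T)`. -/
theorem image_supp_faceVertices {n : ℕ} (C : Set (Option (Fin n))) (T : ColoredTriangulation n) :
    ColoredTriangulation.supp '' faceVertices C T =
      {s | fixedDiagonals C T ⊆ s.diagonals} := by
  ext s
  constructor
  · rintro ⟨S, hS, rfl⟩ z hz
    rw [← fixedDiagonals_eq_of_mem hS] at hz
    exact hz.1
  · intro hs
    have hsub : fixedDiagonals C T ⊆ T.supp.diagonals ∩ s.diagonals := fun z hz => ⟨hz.1, hs hz⟩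
    have key : ∀ u, Relation.ReflTransGen (FlipStep (T.supp.diagonals ∩ s.diagonals)) T.supp u →
        u ∈ ColoredTriangulation.supp '' faceVertices C T := by
      intro u hu
      induction hu with
      | refl => exact ⟨T, self_mem_faceVertices C T, rfl⟩
      | tail _ huv ih =>
        obtain ⟨hv, x, y, hf⟩ := huv
        obtain ⟨R, hR, rfl⟩ := ih
        obtain ⟨S, rfl, hS⟩ := R.exists_isColoredFlip hf
        refine ⟨S, mem_faceVertices_of_isColoredFlip hR ?_ hS, rfl⟩
        -- A flipped diagonal with color outside `C` would be fixed, hence still present after the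
        -- flip.
        by_contra hx
        have : x ∈ fixedDiagonals C T := by
          rw [← fixedDiagonals_eq_of_mem hR]
          exact ⟨hf.1, hx⟩
        exact hf.symm.2.1 (hv (hsub this))
    exact key s (reflTransGen_flipStep s T.supp)

/-- Along a path from `T` with colors in `C`, a flip of color outside `C'` would lose a diagonal
fixed by `C'`, although its result still underlies a vertex of `(C', T)`. -/
theorem faceVertices_subset {n : ℕ} {C C' : Set (Option (Fin n))} {T : ColoredTriangulation n}
    (h : ColoredTriangulation.supp '' faceVertices C T ⊆
      ColoredTriangulation.supp '' faceVertices C' T) :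
    faceVertices C T ⊆ faceVertices C' T := by
  refine faceVertices_induction (self_mem_faceVertices C' T) fun R S c hR hc hf hR' => ?_
  refine mem_faceVertices_of_isColoredFlip hR' ?_ hf
  have hS := h ⟨S, mem_faceVertices_of_isColoredFlip hR hc hf, rfl⟩
  rw [image_supp_faceVertices] at hS
  obtain ⟨x, y, hf, hx, hy, hz⟩ := hf
  by_contra hc'
  refine hf.symm.2.1 (hS ?_)
  rw [← fixedDiagonals_eq_of_mem hR']
  exact ⟨hf.1, by rwa [hx]⟩

/-! ### The quotient by the color permutations -/

theorem isCyclohedronFace_image_supp {n : ℕ} (F : ColorfulCyclohedronFace n) :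
    IsCyclohedronFace (ColoredTriangulation.supp '' F.vertices) := by
  rcases F.isFace with h | ⟨C, T, h⟩
  · exact Or.inl (by rw [h, Set.image_empty])
  · rw [h, image_supp_faceVertices]
    refine Or.inr ⟨T.supp, fixedDiagonals C T, fun x hx => hx.1, fun x hx => ?_, rfl⟩
    exact ⟨T.supp.symmetric x hx.1, by rw [T.color_oppPair hx.1]; exact hx.2⟩

/-- The face of the ordinary cyclohedron obtained by forgetting the colors. -/
def ColorfulCyclohedronFace.uncolor {n : ℕ} (F : ColorfulCyclohedronFace n) :
    CyclohedronFace n :=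
  ⟨ColoredTriangulation.supp '' F.vertices, isCyclohedronFace_image_supp F⟩

theorem uncolor_smul {n : ℕ} (σ : Equiv.Perm (Fin n)) (F : ColorfulCyclohedronFace n) :
    (σ • F).uncolor = F.uncolor := by
  refine CyclohedronFace.ext ?_
  change ColoredTriangulation.supp '' ((fun s => σ • s) '' F.vertices) = _
  rw [Set.image_image]
  rfl

theorem uncolor_surjective {n : ℕ} :
    Function.Surjective (ColorfulCyclohedronFace.uncolor (n := n)) := by
  rintro ⟨V, rfl | ⟨t, D, hDt, hD, rfl⟩⟩
  · exact ⟨⟨∅, Or.inl rfl⟩, CyclohedronFace.ext (Set.image_empty _)⟩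
  · obtain ⟨T, rfl⟩ := t.exists_coloring
    -- As `D` is symmetric, no color occurs both inside and outside `D`, so exactly `D` is fixed.
    set C : Set (Option (Fin n)) := T.color '' (T.supp.diagonals \ D) with hC
    refine ⟨⟨faceVertices C T, Or.inr ⟨C, T, rfl⟩⟩, CyclohedronFace.ext ?_⟩
    refine (image_supp_faceVertices C T).trans ?_
    have : fixedDiagonals C T = D := by
      ext x
      constructor
      · rintro ⟨hx, hxC⟩
        by_contra hxD
        exact hxC ⟨x, ⟨hx, hxD⟩, rfl⟩
      · intro hx
        refine ⟨hDt hx, ?_⟩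
        rintro ⟨y, ⟨hy, hyD⟩, hxy⟩
        rcases ColoredTriangulation.eq_or_eq_oppPair_of_color_eq (hDt hx) hy hxy.symm with rfl | rfl
        · exact hyD hx
        · exact hyD (hD x hx)
    rw [this]

theorem uncolor_mono {n : ℕ} {F G : ColorfulCyclohedronFace n} (h : F ≤ G) :
    F.uncolor ≤ G.uncolor :=
  Set.image_mono (show F.vertices ⊆ G.vertices from h)

/-- A vertex `T` of `F` has the same underlying triangulation as some vertex of `G`; the permutation
relating the two colorings moves `G` to a face through `T`. -/
theorem exists_common_vertex_of_uncolor_le {n : ℕ} {F G : ColorfulCyclohedronFace n}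
    (h : F.uncolor ≤ G.uncolor) (hF : F.vertices ≠ ∅) :
    ∃ (σ : Equiv.Perm (Fin n)) (C C' : Set (Option (Fin n))) (T : ColoredTriangulation n),
      F.vertices = faceVertices C T ∧ (σ • G).vertices = faceVertices C' T := by
  obtain ⟨C, T, hF⟩ := F.isFace.resolve_left hF
  have hT : T.supp ∈ ColoredTriangulation.supp '' G.vertices :=
    (show F.uncolor.vertices ⊆ G.uncolor.vertices from h)
      ⟨T, by rw [hF]; exact self_mem_faceVertices C T, rfl⟩
  obtain ⟨S, hS, hST⟩ := hT
  obtain ⟨C', T', hG⟩ := G.isFace.resolve_left (Set.nonempty_iff_ne_empty.1 ⟨S, hS⟩)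
  obtain ⟨σ, hσ⟩ := ColoredTriangulation.exists_smul_eq hST
  refine ⟨σ, C, Option.map σ '' C', T, hF, ?_⟩
  change (fun s => σ • s) '' G.vertices = _
  rw [hG] at hS ⊢
  rw [faceVertices_eq_of_mem hS, image_smul_faceVertices, hσ]

theorem exists_le_smul_of_uncolor_le {n : ℕ} {F G : ColorfulCyclohedronFace n}
    (h : F.uncolor ≤ G.uncolor) : ∃ σ : Equiv.Perm (Fin n), F ≤ σ • G := by
  by_cases hF : F.vertices = ∅
  · exact ⟨1, show F.vertices ⊆ _ by rw [hF]; exact Set.empty_subset _⟩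
  obtain ⟨σ, C, C', T, h1, h2⟩ := exists_common_vertex_of_uncolor_le h hF
  refine ⟨σ, show F.vertices ⊆ (σ • G).vertices from ?_⟩
  rw [← uncolor_smul σ G] at h
  have h : ColoredTriangulation.supp '' F.vertices ⊆
    ColoredTriangulation.supp '' (σ • G).vertices := h
  rw [h1, h2] at h ⊢
  exact faceVertices_subset h

theorem exists_eq_smul_of_uncolor_eq {n : ℕ} {F G : ColorfulCyclohedronFace n}
    (h : F.uncolor = G.uncolor) : ∃ σ : Equiv.Perm (Fin n), F = σ • G := by
  by_cases hF : F.vertices = ∅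
  · refine ⟨1, ?_⟩
    rw [one_smul]
    refine ColorfulCyclohedronFace.ext ?_
    have h : ColoredTriangulation.supp '' F.vertices = ColoredTriangulation.supp '' G.vertices :=
      congrArg CyclohedronFace.vertices h
    rw [hF, Set.image_empty, eq_comm, Set.image_eq_empty] at h
    rw [hF, h]
  obtain ⟨σ, C, C', T, h1, h2⟩ := exists_common_vertex_of_uncolor_le h.le hF
  refine ⟨σ, ColorfulCyclohedronFace.ext ?_⟩
  rw [← uncolor_smul σ G] at h
  have h : ColoredTriangulation.supp '' F.vertices =
    ColoredTriangulation.supp '' (σ • G).vertices := congrArg CyclohedronFace.vertices h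
  rw [h1, h2] at h ⊢
  exact Set.Subset.antisymm (faceVertices_subset h.le) (faceVertices_subset h.ge)

theorem orbit_smul {n : ℕ} (σ : Equiv.Perm (Fin n)) (F : ColorfulCyclohedronFace n) :
    orbit (σ • F) = orbit F :=
  Quotient.sound (s := MulAction.orbitRel _ _) ⟨σ, rfl⟩

/-- Forgetting the colors, on orbits of faces. -/
def QuotientFace.uncolor {n : ℕ} (P : QuotientFace n) : CyclohedronFace n :=
  Quotient.lift (s := MulAction.orbitRel (Equiv.Perm (Fin n)) (ColorfulCyclohedronFace n))
    ColorfulCyclohedronFace.uncolor (by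
      rintro F G ⟨σ, rfl⟩
      exact uncolor_smul σ G) P

theorem QuotientFace.exists_orbit_eq {n : ℕ} (P : QuotientFace n) : ∃ F, orbit F = P :=
  Quotient.exists_rep P

theorem QuotientFace.uncolor_bijective {n : ℕ} :
    Function.Bijective (QuotientFace.uncolor (n := n)) := by
  constructor
  · intro P Q h
    obtain ⟨F, rfl⟩ := P.exists_orbit_eq
    obtain ⟨G, rfl⟩ := Q.exists_orbit_eq
    obtain ⟨σ, rfl⟩ := exists_eq_smul_of_uncolor_eq h
    exact orbit_smul σ G
  · intro V
    obtain ⟨F, rfl⟩ := uncolor_surjective V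
    exact ⟨orbit F, rfl⟩

theorem QuotientFace.uncolor_le_uncolor_iff {n : ℕ} {P Q : QuotientFace n} :
    P.uncolor ≤ Q.uncolor ↔ P ≤ Q := by
  constructor
  · intro h
    obtain ⟨F, rfl⟩ := P.exists_orbit_eq
    obtain ⟨G, rfl⟩ := Q.exists_orbit_eq
    obtain ⟨σ, hσ⟩ := exists_le_smul_of_uncolor_le h
    exact ⟨F, σ • G, rfl, orbit_smul σ G, hσ⟩
  · rintro ⟨F, G, rfl, rfl, h⟩
    exact uncolor_mono h

end Cyclohedron

/-- The quotient of the colorful cyclohedron by the symmetric group acting on the `n` colors is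
isomorphic, as a partially ordered set of faces, to the ordinary cyclohedron. -/
theorem theorem6p3 (n : ℕ) :
    Nonempty (Cyclohedron.QuotientFace n ≃o Cyclohedron.CyclohedronFace n) :=
  ⟨{ toEquiv := Equiv.ofBijective _ Cyclohedron.QuotientFace.uncolor_bijective
     map_rel_iff' := Cyclohedron.QuotientFace.uncolor_le_uncolor_iff }⟩
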